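/- Let $G=(V,E)$ be a finite connected simple graph such that for every edge $e$ some spanning tree of $G$ does not contain $e$. Give each edge an orientation, a nonzero weight $\gamma_e\in\mathbb R$ and a set $I_e\subset\mathbb R$ that is a finite union of intervals (of any kind, single points allowed) and on which $\sin$ is injective; give each vertex a natural frequency $\omega_i\in\mathbb R$, with $\sum_i\omega_i=0$ (in particular $\omega=0$ is allowed). Let $B:\mathbb R^E\to\mathbb R^V$ be the incidence matrix ($+1$ at the head and $-1$ at the tail of each edge), $B^{-1}$ its Moore–Penrose pseudoinverse, $D_\gamma=\operatorname{diag}(\gamma_e)$, and $v_1,\dots,v_c$ a $\mathbb Z$-basis of the cycle space $\ker B\cap\mathbb Z^E$. Put $$L(\alpha)=D_\gamma^{-1}B^{-1}\omega+\sum_{i=1}^c\alpha_iD_\gamma^{-1}v_i\quad(\alpha\in\mathbb R^c),\qquad A=\{\alpha\in\mathbb R^c: L(\alpha)_e\in\sin(I_e)\text{ for all }e\in E\},$$ let $\sin_{\mathcal I}^{-1}$ be the inverse of the coordinatewise sine restricted to $\prod_e I_e$, and for $\alpha\in A$ let $$W(\alpha)=\frac1{2\pi}\bigl(\langle v_i,\sin_{\mathcal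 I}^{-1}L(\alpha)\rangle\bigr)_{i=1}^c,\qquad W_r(\alpha)=\frac1{2\pi}\bigl(\langle v_i,D_r\sin_{\mathcal I}^{-1}L(\alpha)\rangle\bigr)_{i=1}^c,\qquad D_r=\operatorname{diag}(r_e),$$ where $r_e>0$ for each $e\in E$. For each $M$ let $G_M$ be obtained from $G$ by replacing each edge $e$ by a path of $n_e(M)\ge1$ edges, where $n_e(M)=r_eM+o(M)$ as $M\to\infty$; the edges of the path inherit the orientation, the weight $\gamma_e$ and the set $I_e$ of $e$, old vertices keep their frequencies and new vertices have frequency $0$. Let $A_M$ and $W_M$ be the set and the function defined for $G_M$ as $A$ and $W$ are for $G$, with respect to an arbitrary $\mathbb Z$-basis (of $c$ elements) of the cycle space of $G_M$. Then $W_r(A)$ is Lebesgue measurable with finite volume, each set $W_M(A_M)\cap\mathbb Z^c$ is finite, and $$\lim_{M\to\infty}\frac{\#\bigl(W_M(A_M)\cap\mathbb Z^c\bigr)}{M^c}=|W_r(A)|,$$ where $|\cdot|$ denotes the volume in $\mathbb R^c$. In particular, if $r_e=1$ for all $e$, then the limit equals $|W(A)|$. -/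

import Mathlib

open Filter Topology MeasureTheory Asymptotics

noncomputable section

/-- `P` is the pseudoinverse of the real matrix `B`: the four Penrose equations. -/
structure IsPseudoinverse {m n : Type*} [Fintype m] [Fintype n]
    (B : Matrix m n ℝ) (P : Matrix n m ℝ) : Prop where
  mul_mul_self : B * P * B = B
  mul_mul_inv : P * B * P = P
  symm_left : (B * P).transpose = B * P
  symm_right : (P * B).transpose = P * B

theorem exists_isPseudoinverse {m n : Type*} [Fintype m] [Fintype n]
    (B : Matrix m n ℝ) : ∃ P, IsPseudoinverse B P := by
  classical
  have hS : (B.transpose * B).IsHermitian := by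
    simpa using Matrix.isHermitian_conjTranspose_mul_self B
  obtain ⟨Q, h1, h2, h3, h4⟩ : ∃ Q : Matrix n n ℝ,
      (B.transpose * B) * Q * (B.transpose * B) = B.transpose * B ∧
      Q * (B.transpose * B) * Q = Q ∧ Q.transpose = Q ∧
      Q * (B.transpose * B) = (B.transpose * B) * Q := by
    set U : Matrix n n ℝ := (hS.eigenvectorUnitary : Matrix n n ℝ) with hU
    set d := hS.eigenvalues with hd
    have hUU : U.transpose * U = 1 := by
      have := Unitary.coe_star_mul_self hS.eigenvectorUnitary
      simpa [Matrix.star_eq_conjTranspose] using this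
    have hspec : B.transpose * B = U * Matrix.diagonal d * U.transpose := by
      have := hS.spectral_theorem
      simpa [Unitary.conjStarAlgAut_apply, Matrix.star_eq_conjTranspose, Function.comp_def]
        using this
    have key : ∀ a b : n → ℝ, (U * Matrix.diagonal a * U.transpose) *
        (U * Matrix.diagonal b * U.transpose) =
        U * Matrix.diagonal (fun i => a i * b i) * U.transpose := by
      intro a b
      calc _ = U * Matrix.diagonal a * (U.transpose * U) * Matrix.diagonal b * U.transpose := by
            simp only [Matrix.mul_assoc]
        _ = _ := by
            rw [hUU, Matrix.mul_one, Matrix.mul_assoc U, Matrix.diagonal_mul_diagonal]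
    refine ⟨U * Matrix.diagonal (fun i => (d i)⁻¹) * U.transpose, ?_, ?_, ?_, ?_⟩
    · rw [hspec, key, key]
      congr 3
      funext i
      by_cases h : d i = 0 <;> simp [h]
    · rw [hspec, key, key]
      congr 3
      funext i
      by_cases h : d i = 0 <;> simp [h]
    · simp [Matrix.transpose_mul, Matrix.mul_assoc]
    · rw [hspec, key, key]
      congr 3
      funext i
      exact mul_comm _ _
  refine ⟨Q * B.transpose, ?_, ?_, ?_, ?_⟩
  · have h0 : (B * Q * (B.transpose * B) - B).conjTranspose *
        (B * Q * (B.transpose * B) - B) = 0 := by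
      have : B.transpose * (B * Q * (B.transpose * B) - B) = 0 := by
        have h5 : B.transpose * (B * Q * (B.transpose * B)) =
            B.transpose * B * Q * (B.transpose * B) := by simp only [Matrix.mul_assoc]
        rw [Matrix.mul_sub, sub_eq_zero, h5, h1]
      have e : (B * Q * (B.transpose * B) - B) = B * (Q * (B.transpose * B) - 1) := by
        rw [Matrix.mul_sub, Matrix.mul_one, Matrix.mul_assoc]
      rw [Matrix.conjTranspose_eq_transpose_of_trivial]
      nth_rewrite 1 [e]
      rw [Matrix.transpose_mul, Matrix.mul_assoc, this, Matrix.mul_zero]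
    have := sub_eq_zero.mp (Matrix.conjTranspose_mul_self_eq_zero.mp h0)
    simpa [Matrix.mul_assoc] using this
  · have : Q * B.transpose * B * (Q * B.transpose) =
        Q * (B.transpose * B) * Q * B.transpose := by simp only [Matrix.mul_assoc]
    rw [this, h2]
  · simp [Matrix.transpose_mul, h3, Matrix.mul_assoc]
  · rw [Matrix.mul_assoc, Matrix.transpose_mul, h3, h4]
    simp [Matrix.transpose_mul]

/-- The (Moore-Penrose) pseudoinverse of a real matrix. -/
def pseudoinverse {m n : Type*} [Fintype m] [Fintype n] (B : Matrix m n ℝ) : Matrix n m ℝ :=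
  Classical.choose (exists_isPseudoinverse B)

theorem pseudoinverse_spec {m n : Type*} [Fintype m] [Fintype n] (B : Matrix m n ℝ) :
    IsPseudoinverse B (pseudoinverse B) :=
  Classical.choose_spec (exists_isPseudoinverse B)

/-- The Penrose equations have only one solution, so the choice above is no choice. -/
theorem IsPseudoinverse.eq_pseudoinverse {m n : Type*} [Fintype m] [Fintype n]
    {B : Matrix m n ℝ} {P : Matrix n m ℝ} (hP : IsPseudoinverse B P) :
    P = pseudoinverse B := by
  have hQ := pseudoinverse_spec B
  set Q := pseudoinverse B
  have hl : B * P = B * Q := by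
    have h : (B * Q) * (B * P) = B * P := by
      rw [← Matrix.mul_assoc, hQ.mul_mul_self]
    have h' : (B * P) * (B * Q) = B * Q := by
      rw [← Matrix.mul_assoc, hP.mul_mul_self]
    have t := congrArg Matrix.transpose h'
    rw [Matrix.transpose_mul, hP.symm_left, hQ.symm_left, h] at t
    exact t
  have hr : P * B = Q * B := by
    have h : (P * B) * (Q * B) = P * B := by
      rw [Matrix.mul_assoc, ← Matrix.mul_assoc B, hQ.mul_mul_self]
    have h' : (Q * B) * (P * B) = Q * B := by
      rw [Matrix.mul_assoc, ← Matrix.mul_assoc B, hP.mul_mul_self]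
    have t := congrArg Matrix.transpose h'
    rw [Matrix.transpose_mul, hP.symm_right, hQ.symm_right, h] at t
    exact t
  calc P = P * B * P := hP.mul_mul_inv.symm
    _ = Q * (B * P) := by rw [hr, Matrix.mul_assoc]
    _ = Q := by rw [hl, ← Matrix.mul_assoc, hQ.mul_mul_inv]

/-- A network of Kuramoto oscillators: a graph with vertices `V` and edges `E`, each edge having
a direction (from `tail` to `head`), a coupling weight `γ` and a set `I` of admissible angle
differences `θ (head e) - θ (tail e)` modulo `2π`, and each vertex a natural frequency `ω`. -/
structure Network (V E : Type*) where
  tail : E → V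
  head : E → V
  γ : E → ℝ
  ω : V → ℝ
  I : E → Set ℝ

namespace Network

variable {V E : Type*}

/-- No loops and no multiple edges. -/
def IsSimple (G : Network V E) : Prop :=
  (∀ e, G.tail e ≠ G.head e) ∧ Function.Injective (fun e => s(G.tail e, G.head e))

/-- The underlying undirected graph. -/
def toSimpleGraph (G : Network V E) : SimpleGraph V :=
  SimpleGraph.fromEdgeSet (Set.range fun e => s(G.tail e, G.head e))

open Classical in
/-- The incidence matrix: `1` at the head, `-1` at the tail of an edge, `0` elsewhere
(for edges that are not loops). -/
def incidence (G : Network V E) (R : Type*) [Ring R] : Matrix V E R :=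
  Matrix.of fun i e => (if G.head e = i then 1 else 0) - (if G.tail e = i then 1 else 0)

variable [Fintype V] [Fintype E]

/-- The cycle space: the integral vectors in the kernel of the incidence matrix. -/
def cycleSpace (G : Network V E) : Submodule ℤ (E → ℤ) :=
  LinearMap.ker (Matrix.mulVecLin (G.incidence ℤ))

/-- `L(α) = D_γ⁻¹ B⁻¹ ω + ∑ i, α_i D_γ⁻¹ v_i`, with `B⁻¹` the pseudoinverse of the incidence
matrix. -/
def L (G : Network V E) {c : ℕ} (v : Module.Basis (Fin c) ℤ G.cycleSpace)
    (α : Fin c → ℝ) : E → ℝ := fun e =>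
  (G.γ e)⁻¹ * (pseudoinverse (G.incidence ℝ)).mulVec G.ω e
    + ∑ i, α i * ((G.γ e)⁻¹ * ((v i : E → ℤ) e : ℝ))

/-- The set `A` of all `α` at which the inverse of the sine restricted to the product of the
`I e` is defined at `L(α)`. -/
def A (G : Network V E) {c : ℕ} (v : Module.Basis (Fin c) ℤ G.cycleSpace) :
    Set (Fin c → ℝ) :=
  {α | ∀ e, G.L v α e ∈ Real.sin '' G.I e}

/-- The inverse of the sine restricted to the product of the `I e` (meaningful at `x` with
`x e ∈ sin (I e)` for all `e`, when the sine is injective on each `I e`). -/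
def arcsin (G : Network V E) (x : E → ℝ) : E → ℝ :=
  fun e => Function.invFunOn Real.sin (G.I e) (x e)

/-- The winding numbers `W(α)_i = ⟨v_i, arcsin L(α)⟩ / 2π`. -/
def W (G : Network V E) {c : ℕ} (v : Module.Basis (Fin c) ℤ G.cycleSpace)
    (α : Fin c → ℝ) : Fin c → ℝ := fun i =>
  1 / (2 * Real.pi) * ∑ e, ((v i : E → ℤ) e : ℝ) * G.arcsin (G.L v α) e

/-- The weighted winding numbers `W_r(α)_i = ⟨v_i, D_r arcsin L(α)⟩ / 2π`. -/
def Wr (G : Network V E) {c : ℕ} (v : Module.Basis (Fin c) ℤ G.cycleSpace) (r : E → ℝ)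
    (α : Fin c → ℝ) : Fin c → ℝ := fun i =>
  1 / (2 * Real.pi) * ∑ e, ((v i : E → ℤ) e : ℝ) * (r e * G.arcsin (G.L v α) e)

/-- The `k`-th vertex, `0 ≤ k ≤ n e`, of the path of length `n e` that replaces the edge `e`:
the old tail of `e` for `k = 0`, the old head of `e` for `k = n e`, and otherwise one of the
`n e - 1` new vertices. -/
def pathVertex (G : Network V E) (n : E → ℕ) (e : E) (k : ℕ) : V ⊕ (Σ e : E, Fin (n e - 1)) :=
  if k = 0 then Sum.inl (G.tail e)
  else if h : k - 1 < n e - 1 then Sum.inr ⟨e, ⟨k - 1, h⟩⟩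
  else Sum.inl (G.head e)

/-- The subdivision of `G` in which each edge `e` is replaced by a path of `n e ≥ 1` edges.
The edges of the path are directed like `e` and inherit its weight and its set of admissible
angle differences; new vertices have natural frequency `0`. -/
def subdivide (G : Network V E) (n : E → ℕ) :
    Network (V ⊕ (Σ e : E, Fin (n e - 1))) (Σ e : E, Fin (n e)) where
  tail e' := G.pathVertex n e'.1 e'.2
  head e' := G.pathVertex n e'.1 (e'.2 + 1)
  γ e' := G.γ e'.1
  ω := Sum.elim G.ω (fun _ => 0)
  I e' := G.I e'.1

end Network

/-- The lattice `ℤ^c` in `ℝ^c`. -/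
def integerLattice (c : ℕ) : Set (Fin c → ℝ) :=
  Set.range fun (k : Fin c → ℤ) (i : Fin c) => (k i : ℝ)

/-- A union of finitely many intervals (open, closed, half-open or single points). -/
def IsFiniteUnionOfIntervals (S : Set ℝ) : Prop :=
  ∃ F : Set (Set ℝ), F.Finite ∧ (∀ J ∈ F, J.OrdConnected) ∧ S = ⋃₀ F

end

/-! Kirchhoff form: when `ω` lies in the range of the incidence matrix, `L α` runs through all `x`
for which the flow `γ e * x e` has divergence `ω` (`exists_L_eq_iff`). Hence a point of `W_r(A)` is
the same as a choice of angles `θ e ∈ I e` whose flow `γ e * sin (θ e)` balances `ω`, read off along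
the basis cycles with weights `r`. In a subdivision, balance at the new vertices of frequency zero
makes the sine constant along each path, and injectivity makes the angle constant. So `W_M(A_M)` is
the image of the original `A` with weights `n M e`, in a transported basis (`subdivide_W_image_A`),
and the choice of basis does not affect the number of integral points. Dividing by `M` leaves the
points of the lattice `ℤ^c / M` in a set whose weights `ρ = n M / M` converge to `r`.

These sets vary with `M`, so they are squeezed. They eventually lie in any neighbourhood of the
compact set `C` obtained at `r` from the closures of the `I e`, and they eventually contain any
compact part of the open set `U` of values stable under perturbation of value and weights. The
difference `C \ U` is null (`volume_windingSet_closure_diff`). If an angle is a frontier point, then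
`α` lies on a hyperplane, a genuine one because no edge is a bridge, and the differentiable image is
null. If all angles are interior, either the value is critical, hence in a null set by Sard in equal
dimensions, or the open mapping property puts it in `U`. Injectivity of `W_r` plays no role. -/

noncomputable section

/-! ### Counting points of a shrinking lattice -/

/-- The half-open cube of side `1 / M` at the lattice point `k / M`. -/
def latticeCube {c : ℕ} (M : ℕ) (k : Fin c → ℤ) : Set (Fin c → ℝ) :=
  Set.univ.pi fun i => Set.Ico ((k i : ℝ) / M) ((k i : ℝ) / M + 1 / M)

theorem measurableSet_latticeCube {c : ℕ} (M : ℕ) (k : Fin c → ℤ) :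
    MeasurableSet (latticeCube M k) :=
  MeasurableSet.univ_pi fun _ => measurableSet_Ico

theorem volume_latticeCube {c : ℕ} (M : ℕ) (k : Fin c → ℤ) :
    volume (latticeCube M k) = ENNReal.ofReal ((1 / M : ℝ) ^ c) := by
  rw [latticeCube, volume_pi_pi, ENNReal.ofReal_pow (by positivity)]
  simp [Real.volume_Ico]

theorem mem_latticeCube_iff {c M : ℕ} (hM : 0 < M) (k : Fin c → ℤ) (x : Fin c → ℝ) :
    x ∈ latticeCube M k ↔ ∀ i, k i = ⌊x i * M⌋ := by
  have hM' : (0 : ℝ) < M := by exact_mod_cast hM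
  simp only [latticeCube, Set.mem_univ_pi, Set.mem_Ico]
  refine forall_congr' fun i => ?_
  rw [eq_comm, Int.floor_eq_iff, div_le_iff₀ hM', ← add_div, lt_div_iff₀ hM']

theorem pairwise_disjoint_latticeCube {c M : ℕ} (hM : 0 < M) :
    Pairwise (Function.onFun Disjoint (latticeCube (c := c) M)) := by
  intro k l hkl
  refine Set.disjoint_left.2 fun x hk hl => hkl ?_
  rw [mem_latticeCube_iff hM] at hk hl
  exact funext fun i => (hk i).trans (hl i).symm

theorem dist_le_of_mem_latticeCube {c M : ℕ} {k : Fin c → ℤ} {x : Fin c → ℝ}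
    (hx : x ∈ latticeCube M k) : dist x (fun i => (k i : ℝ) / M) ≤ 1 / M := by
  rw [dist_pi_le_iff (by positivity)]
  intro i
  have := hx i (Set.mem_univ i)
  simp only [Set.mem_Ico] at this
  rw [Real.dist_eq, abs_le]
  have h1 : (0 : ℝ) ≤ 1 / M := by positivity
  constructor <;> linarith

/-- The lattice points `k` with `k / M ∈ Y`. -/
def scaledLatticePoints {c : ℕ} (M : ℕ) (Y : Set (Fin c → ℝ)) : Set (Fin c → ℤ) :=
  {k | (fun i => (k i : ℝ) / M) ∈ Y}

theorem finite_scaledLatticePoints {c M : ℕ} (hM : 0 < M) {Y : Set (Fin c → ℝ)}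
    (hY : Bornology.IsBounded Y) : (scaledLatticePoints M Y).Finite := by
  obtain ⟨R, hR⟩ := hY.exists_norm_le
  have hM' : (0 : ℝ) < M := by exact_mod_cast hM
  refine (Set.Finite.pi' (t := fun _ : Fin c => Set.Icc ⌊-(R * M)⌋ ⌈R * M⌉)
    fun _ => Set.finite_Icc _ _).subset ?_
  intro k hk i
  have h := (norm_le_pi_norm _ i).trans (hR _ hk)
  rw [Real.norm_eq_abs, abs_le, le_div_iff₀ hM', div_le_iff₀ hM', neg_mul] at h
  exact ⟨Int.floor_le_iff.2 (by linarith [h.1]), by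
    exact_mod_cast h.2.trans (Int.le_ceil _)⟩

theorem volume_iUnion_latticeCube {c M : ℕ} (hM : 0 < M) {S : Set (Fin c → ℤ)} (hS : S.Finite) :
    volume (⋃ k ∈ S, latticeCube M k) = ENNReal.ofReal (S.ncard / (M : ℝ) ^ c) := by
  rw [measure_biUnion hS.countable
    (fun k _ l _ h => pairwise_disjoint_latticeCube hM h)
    (fun k _ => measurableSet_latticeCube M k)]
  simp only [volume_latticeCube]
  rw [ENNReal.tsum_const, div_eq_mul_inv (S.ncard : ℝ), ENNReal.ofReal_mul (by positivity)]
  congr 1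
  · rw [ENat.card_coe_set_eq, ← hS.cast_ncard_eq]
    simp
  · simp

/-- Counting lattice points in sets that are squeezed between an open set and the
neighbourhoods of a compact set of the same volume. -/
theorem tendsto_card_scaledLatticePoints {c : ℕ} (Y : ℕ → Set (Fin c → ℝ))
    {C U : Set (Fin c → ℝ)} (hC : IsCompact C) (hU : IsOpen U) (hUC : U ⊆ C)
    (hvol : volume (C \ U) = 0)
    (hup : ∀ ε > 0, ∀ᶠ M in atTop, Y M ⊆ Metric.cthickening ε C)
    (hlow : ∀ K ⊆ U, IsCompact K → ∀ᶠ M in atTop, K ⊆ Y M) :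
    Tendsto (fun M : ℕ => ((scaledLatticePoints M (Y M)).ncard : ℝ) / (M : ℝ) ^ c) atTop
      (𝓝 (volume C).toReal) := by
  have hCtop : volume C ≠ ⊤ := hC.measure_ne_top
  have hUvol : volume U = volume C := by
    refine le_antisymm (measure_mono hUC) ?_
    calc volume C ≤ volume (C \ U) + volume U := by
          rw [← measure_sdiff_add_inter C hU.measurableSet]
          gcongr
          exact Set.inter_subset_right
      _ = volume U := by rw [hvol, zero_add]
  have hfin : ∀ᶠ M : ℕ in atTop, (scaledLatticePoints M (Y M)).Finite := by
    filter_upwards [hup 1 one_pos, eventually_gt_atTop 0] with M h hM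
    exact finite_scaledLatticePoints hM (hC.isBounded.cthickening.subset h)
  have hinv : ∀ δ > 0, ∀ᶠ M : ℕ in atTop, 1 / (M : ℝ) < δ := fun δ hδ =>
    (tendsto_one_div_atTop_nhds_zero_nat (𝕜 := ℝ)).eventually_lt_const hδ
  refine tendsto_order.2 ⟨fun a ha => ?_, fun a ha => ?_⟩
  · obtain ha0 | ha0 := lt_or_ge a 0
    · exact Eventually.of_forall fun M => ha0.trans_le (by positivity)
    rw [← hUvol, ← ENNReal.ofReal_lt_iff_lt_toReal ha0 (hUvol ▸ hCtop)] at ha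
    -- Inner regularity gives a compact `K` of almost full volume with a closed neighbourhood still
    -- in `U`. The corner of the cube around a point of `K` stays in that neighbourhood, so the
    -- counted cubes cover `K`.
    obtain ⟨K, hKU, hK, haK⟩ := hU.exists_lt_isCompact ha
    obtain ⟨δ, hδ, hKδ⟩ := hK.exists_cthickening_subset_open hU hKU
    filter_upwards [hlow _ hKδ hK.cthickening, hinv δ hδ, eventually_gt_atTop 0, hfin]
      with M h1 h2 hM h3
    have hsub : K ⊆ ⋃ k ∈ scaledLatticePoints M (Y M), latticeCube M k := by
      intro x hx
      have hx' : x ∈ latticeCube M fun i => ⌊x i * M⌋ :=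
        (mem_latticeCube_iff hM _ _).2 fun i => rfl
      refine Set.mem_biUnion (h1 ?_) hx'
      refine Metric.mem_cthickening_of_dist_le _ x _ _ hx ?_
      rw [dist_comm]
      exact (dist_le_of_mem_latticeCube hx').trans h2.le
    have := haK.trans_le (measure_mono hsub)
    rw [volume_iUnion_latticeCube hM h3] at this
    exact (ENNReal.ofReal_lt_ofReal_iff_of_nonneg ha0).1 this
  · have hlim := tendsto_measure_cthickening_of_isCompact (μ := volume) hC
    have ha' : volume C < ENNReal.ofReal a :=
      (ENNReal.lt_ofReal_iff_toReal_lt hCtop).2 ha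
    obtain ⟨δ, hδ, hδa⟩ : ∃ δ > 0, volume (Metric.cthickening δ C) < ENNReal.ofReal a := by
      have h1 := (hlim.mono_left (nhdsWithin_le_nhds (s := Set.Ioi 0))).eventually_lt_const ha'
      obtain ⟨δ, h, hδ⟩ := (h1.and self_mem_nhdsWithin).exists
      exact ⟨δ, hδ, h⟩
    -- One half of `δ` pays for the distance from `Y M` to `C`, the other for the size of a cube.
    filter_upwards [hup (δ / 2) (by positivity), hinv (δ / 2) (by positivity),
      eventually_gt_atTop 0, hfin] with M h1 h2 hM h3
    have hsub : (⋃ k ∈ scaledLatticePoints M (Y M), latticeCube M k) ⊆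
        Metric.cthickening δ C := by
      refine Set.iUnion₂_subset fun k hk x hx => ?_
      have h4 := h1 hk
      rw [show δ = δ / 2 + δ / 2 by ring]
      refine Metric.cthickening_cthickening_subset (by positivity) (by positivity) C ?_
      exact Metric.mem_cthickening_of_dist_le _ _ _ _ h4
        ((dist_le_of_mem_latticeCube hx).trans h2.le)
    have := (measure_mono hsub).trans_lt hδa
    rw [volume_iUnion_latticeCube hM h3] at this
    exact (ENNReal.ofReal_lt_ofReal_iff_of_nonneg (by positivity)).1 this

end

noncomputable section

/-! ### Intervals and local inverses of the sine -/

/-- An interval with points `2π` or more apart contains some `y` together with `y + 2π`. -/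
theorem Set.OrdConnected.isBounded_of_injOn_sin {J : Set ℝ} (hJ : J.OrdConnected)
    (hs : Set.InjOn Real.sin J) : Bornology.IsBounded J := by
  obtain rfl | ⟨x, hx⟩ := J.eq_empty_or_nonempty
  · exact Bornology.isBounded_empty
  have hpi := Real.pi_pos
  have key : ∀ y ∈ J, ∀ z ∈ J, z < y + 2 * Real.pi := by
    intro y hy z hz
    by_contra! h
    have hmem : y + 2 * Real.pi ∈ J := hJ.out hy hz ⟨by linarith, h⟩
    have := hs hmem hy (Real.sin_add_two_pi y)
    linarith
  refine (Metric.isBounded_Icc (x - 2 * Real.pi) (x + 2 * Real.pi)).subset fun y hy => ?_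
  exact ⟨by linarith [key y hy x hx], (key x hx y hy).le⟩

theorem Set.OrdConnected.finite_frontier {J : Set ℝ} (hJ : J.OrdConnected)
    (hb : Bornology.IsBounded J) : (frontier J).Finite := by
  obtain rfl | hne := J.eq_empty_or_nonempty
  · simp
  have hcl : closure J ⊆ Set.Icc (sInf J) (sSup J) :=
    closure_minimal (subset_Icc_csInf_csSup hb.bddBelow hb.bddAbove) isClosed_Icc
  have hint : Set.Ioo (sInf J) (sSup J) ⊆ interior J := by
    refine interior_maximal (fun x hx => ?_) isOpen_Ioo
    obtain ⟨y, hy, hyx⟩ := (csInf_lt_iff hb.bddBelow hne).1 hx.1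
    obtain ⟨z, hz, hxz⟩ := (lt_csSup_iff hb.bddAbove hne).1 hx.2
    exact hJ.out hy hz ⟨hyx.le, hxz.le⟩
  refine (Set.toFinite {sInf J, sSup J}).subset fun x hx => ?_
  have h1 := hcl hx.1
  by_contra h
  simp only [Set.mem_insert_iff, Set.mem_singleton_iff, not_or] at h
  exact hx.2 (hint ⟨lt_of_le_of_ne h1.1 (Ne.symm h.1), lt_of_le_of_ne h1.2 h.2⟩)

theorem IsFiniteUnionOfIntervals.isBounded_of_injOn_sin {S : Set ℝ}
    (hS : IsFiniteUnionOfIntervals S) (hs : Set.InjOn Real.sin S) : Bornology.IsBounded S := by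
  obtain ⟨F, hF, hJ, rfl⟩ := hS
  exact (Bornology.isBounded_sUnion hF).2 fun J h =>
    (hJ J h).isBounded_of_injOn_sin (hs.mono (Set.subset_sUnion_of_mem h))

theorem IsFiniteUnionOfIntervals.finite_frontier {S : Set ℝ}
    (hS : IsFiniteUnionOfIntervals S) (hb : Bornology.IsBounded S) : (frontier S).Finite := by
  obtain ⟨F, hF, hJ, rfl⟩ := hS
  refine (hF.biUnion fun J h => (hJ J h).finite_frontier
    (hb.subset (Set.subset_sUnion_of_mem h))).subset fun x hx => ?_
  have hx1 := hx.1
  rw [hF.closure_sUnion] at hx1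
  simp only [Set.mem_iUnion, exists_prop] at hx1 ⊢
  obtain ⟨J, hJF, hxJ⟩ := hx1
  exact ⟨J, hJF, hxJ, fun h => hx.2 (interior_mono (Set.subset_sUnion_of_mem hJF) h)⟩

/-- The sine is symmetric about a zero of the cosine, hence not injective near it. -/
theorem Real.cos_ne_zero_of_injOn_sin {S : Set ℝ} (hs : Set.InjOn Real.sin S) {x : ℝ}
    (hx : x ∈ interior S) : Real.cos x ≠ 0 := by
  intro h
  obtain ⟨δ, hδ, hball⟩ := Metric.mem_nhds_iff.1 (mem_interior_iff_mem_nhds.1 hx)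
  have h1 : x + δ / 2 ∈ S := hball (by simp [abs_of_pos hδ, hδ])
  have h2 : x - δ / 2 ∈ S := hball (by simp [abs_of_pos hδ, hδ])
  have := hs h1 h2 (by rw [Real.sin_add, Real.sin_sub, h]; ring)
  linarith

theorem hasStrictDerivAt_invFunOn_sin {S : Set ℝ} (hs : Set.InjOn Real.sin S) {x : ℝ}
    (hx : x ∈ interior S) :
    HasStrictDerivAt (Function.invFunOn Real.sin S) (Real.cos x)⁻¹ (Real.sin x) := by
  refine (Real.hasStrictDerivAt_sin x).to_local_left_inverse
    (Real.cos_ne_zero_of_injOn_sin hs hx) ?_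
  filter_upwards [mem_interior_iff_mem_nhds.1 hx] with y hy
  exact hs (Function.invFunOn_mem ⟨y, hy, rfl⟩) hy (Function.invFunOn_eq ⟨y, hy, rfl⟩)

theorem sin_image_interior_mem_nhds {S : Set ℝ} (hs : Set.InjOn Real.sin S) {x : ℝ}
    (hx : x ∈ interior S) : Real.sin '' interior S ∈ 𝓝 (Real.sin x) := by
  rw [← (Real.hasStrictDerivAt_sin x).map_nhds_eq (Real.cos_ne_zero_of_injOn_sin hs hx)]
  exact image_mem_map (isOpen_interior.mem_nhds hx)

/-! ### Winding sets: compactness, stability and null boundary -/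

variable {E : Type*} [Fintype E] {c : ℕ}

/-- The linear combinations with coefficients `m i e * ρ e` of angles `θ e ∈ I e` for which
`sin θ` lies in the range of the affine map `α ↦ b + ℓ α`. -/
def windingSet (ℓ : E → (Fin c → ℝ) →L[ℝ] ℝ) (b : E → ℝ) (m : Fin c → E → ℝ)
    (I : E → Set ℝ) (ρ : E → ℝ) : Set (Fin c → ℝ) :=
  {y | ∃ (α : Fin c → ℝ) (θ : E → ℝ), (∀ e, θ e ∈ I e) ∧ (∀ e, b e + ℓ e α = Real.sin (θ e)) ∧
    y = fun i => ∑ e, m i e * (ρ e * θ e)}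

variable {ℓ : E → (Fin c → ℝ) →L[ℝ] ℝ} {b : E → ℝ} {m : Fin c → E → ℝ} {I : E → Set ℝ}

theorem windingSet_mono {I' : E → Set ℝ} (h : ∀ e, I e ⊆ I' e) (ρ : E → ℝ) :
    windingSet ℓ b m I ρ ⊆ windingSet ℓ b m I' ρ := by
  rintro y ⟨α, θ, h1, h2, h3⟩
  exact ⟨α, θ, fun e => h e (h1 e), h2, h3⟩

/-- The compactness concerns `θ`, since `α` may be unbounded when the `ℓ e` have a common kernel.
Closedness holds because the range of a linear map in finite dimension is closed. -/
theorem isCompact_angles {E : Type*} {c : ℕ} {ℓ : E → (Fin c → ℝ) →L[ℝ] ℝ} {b : E → ℝ}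
    {I : E → Set ℝ} (hb : ∀ e, Bornology.IsBounded (I e)) :
    IsCompact {θ : E → ℝ | (∀ e, θ e ∈ closure (I e)) ∧
      ∃ α, ∀ e, b e + ℓ e α = Real.sin (θ e)} := by
  have h1 : IsCompact (Set.univ.pi fun e => closure (I e)) :=
    isCompact_univ_pi fun e => (hb e).isCompact_closure
  have h2 : IsClosed {θ : E → ℝ | (fun e => Real.sin (θ e) - b e) ∈
      LinearMap.range (LinearMap.pi fun e => (ℓ e : (Fin c → ℝ) →ₗ[ℝ] ℝ))} :=
    (Submodule.closed_of_finiteDimensional _).preimage (by fun_prop)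
  convert h1.inter_right h2 using 1
  ext θ
  simp only [Set.mem_ofPred_eq, Set.mem_inter_iff, Set.mem_univ_pi, LinearMap.mem_range,
    funext_iff, LinearMap.pi_apply, ContinuousLinearMap.coe_coe, eq_sub_iff_add_eq']

theorem windingSet_closure_eq_image (ρ : E → ℝ) :
    windingSet ℓ b m (fun e => closure (I e)) ρ =
      (fun (θ : E → ℝ) i => ∑ e, m i e * (ρ e * θ e)) '' {θ : E → ℝ |
        (∀ e, θ e ∈ closure (I e)) ∧ ∃ α, ∀ e, b e + ℓ e α = Real.sin (θ e)} := by
  ext y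
  constructor
  · rintro ⟨α, θ, h1, h2, rfl⟩
    exact ⟨θ, ⟨h1, α, h2⟩, rfl⟩
  · rintro ⟨θ, ⟨h1, α, h2⟩, rfl⟩
    exact ⟨α, θ, h1, h2, rfl⟩

theorem isCompact_windingSet_closure (hb : ∀ e, Bornology.IsBounded (I e)) (ρ : E → ℝ) :
    IsCompact (windingSet ℓ b m (fun e => closure (I e)) ρ) := by
  rw [windingSet_closure_eq_image]
  exact (isCompact_angles hb).image (by fun_prop)

/-- The set of admissible angles does not depend on the weights and has compact closure, so the tube
lemma gives a neighbourhood of `r` that works for all angles at once. -/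
theorem eventually_windingSet_subset_cthickening (hb : ∀ e, Bornology.IsBounded (I e))
    (r : E → ℝ) {ε : ℝ} (hε : 0 < ε) :
    ∀ᶠ ρ in 𝓝 r, windingSet ℓ b m I ρ ⊆
      Metric.cthickening ε (windingSet ℓ b m (fun e => closure (I e)) r) := by
  set X := {θ : E → ℝ | (∀ e, θ e ∈ closure (I e)) ∧ ∃ α, ∀ e, b e + ℓ e α = Real.sin (θ e)}
    with hX
  set C := windingSet ℓ b m (fun e => closure (I e)) r with hC
  let f : (E → ℝ) × (E → ℝ) → Fin c → ℝ := fun p i => ∑ e, m i e * (p.1 e * p.2 e)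
  have hf : Continuous f := by fun_prop
  have hopen : IsOpen (f ⁻¹' Metric.thickening ε C) := Metric.isOpen_thickening.preimage hf
  have hXC : {r} ×ˢ X ⊆ f ⁻¹' Metric.thickening ε C := by
    rintro ⟨ρ, θ⟩ ⟨h0, h1, α, h2⟩
    obtain rfl : ρ = r := h0
    have : f (ρ, θ) ∈ C := ⟨α, θ, h1, h2, rfl⟩
    exact Metric.self_subset_thickening hε C this
  obtain ⟨u, v, hu, -, hru, hXv, huv⟩ :=
    generalized_tube_lemma isCompact_singleton (isCompact_angles hb) hopen hXC
  filter_upwards [hu.mem_nhds (hru rfl)] with ρ hρ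
  rintro y ⟨α, θ, h1, h2, rfl⟩
  have hθ : θ ∈ X := ⟨fun e => subset_closure (h1 e), α, h2⟩
  have h3 : f (ρ, θ) ∈ Metric.thickening ε C := huv (Set.mk_mem_prod hρ (hXv hθ))
  exact Metric.thickening_subset_cthickening ε C h3

/-- The values that are attained stably under perturbation of the weights. -/
def stableWindingSet (ℓ : E → (Fin c → ℝ) →L[ℝ] ℝ) (b : E → ℝ) (m : Fin c → E → ℝ)
    (I : E → Set ℝ) (r : E → ℝ) : Set (Fin c → ℝ) :=
  {y | {p : (Fin c → ℝ) × (E → ℝ) | p.1 ∈ windingSet ℓ b m I p.2} ∈ 𝓝 (y, r)}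

theorem stableWindingSet_subset (r : E → ℝ) :
    stableWindingSet ℓ b m I r ⊆ windingSet ℓ b m I r := fun y hy =>
  mem_of_mem_nhds (x := (y, r)) (s := {p | p.1 ∈ windingSet ℓ b m I p.2}) hy

theorem isOpen_stableWindingSet (r : E → ℝ) : IsOpen (stableWindingSet ℓ b m I r) := by
  have : stableWindingSet ℓ b m I r = (fun y => (y, r)) ⁻¹'
      interior {p : (Fin c → ℝ) × (E → ℝ) | p.1 ∈ windingSet ℓ b m I p.2} := by
    ext y
    simp only [stableWindingSet, Set.mem_ofPred_eq, Set.mem_preimage, mem_interior_iff_mem_nhds]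
  rw [this]
  exact isOpen_interior.preimage (by fun_prop)

theorem eventually_subset_windingSet {r : E → ℝ} {K : Set (Fin c → ℝ)}
    (hKU : K ⊆ stableWindingSet ℓ b m I r) (hK : IsCompact K) :
    ∀ᶠ ρ in 𝓝 r, K ⊆ windingSet ℓ b m I ρ := by
  obtain ⟨u, v, -, hv, hKu, hrv, huv⟩ := generalized_tube_lemma hK (isCompact_singleton (x := r))
    (isOpen_interior (s := {p : (Fin c → ℝ) × (E → ℝ) | p.1 ∈ windingSet ℓ b m I p.2}))
    (by
      rintro ⟨y, ρ⟩ ⟨hy, rfl⟩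
      exact mem_interior_iff_mem_nhds.2 (hKU hy))
  filter_upwards [hv.mem_nhds (hrv rfl)] with ρ hρ y hy
  have := interior_subset (huv (Set.mk_mem_prod (hKu hy) hρ))
  exact this

/-- Strict differentiability jointly in `α` and the weights is what the open mapping argument with
varying weights requires. -/
theorem exists_hasStrictFDerivAt_sum (ℓ : E → (Fin c → ℝ) →L[ℝ] ℝ) (b : E → ℝ)
    (m : Fin c → E → ℝ) {g : E → ℝ → ℝ} {g' : E → ℝ}
    {α : Fin c → ℝ} (hg : ∀ e, HasStrictDerivAt (g e) (g' e) (b e + ℓ e α)) (ρ : E → ℝ) :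
    ∃ D : (Fin c → ℝ) × (E → ℝ) →L[ℝ] (Fin c → ℝ),
      HasStrictFDerivAt (fun p : (Fin c → ℝ) × (E → ℝ) =>
        (fun i => ∑ e, m i e * (p.2 e * g e (b e + ℓ e p.1)) : Fin c → ℝ)) D (α, ρ) := by
  have h1 : ∀ e, ∃ D : (Fin c → ℝ) × (E → ℝ) →L[ℝ] ℝ, HasStrictFDerivAt
      (fun p : (Fin c → ℝ) × (E → ℝ) => p.2 e * g e (b e + ℓ e p.1)) D (α, ρ) := by
    intro e
    have h2 : HasStrictFDerivAt (fun p : (Fin c → ℝ) × (E → ℝ) => b e + ℓ e p.1)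
        ((ℓ e).comp (ContinuousLinearMap.fst ℝ _ _)) (α, ρ) :=
      HasStrictFDerivAt.const_add (b e)
        ((ℓ e).comp (ContinuousLinearMap.fst ℝ (Fin c → ℝ) (E → ℝ))).hasStrictFDerivAt
    have h3 := HasStrictDerivAt.comp_hasStrictFDerivAt (α, ρ) (hg e) h2
    exact ⟨_, (((ContinuousLinearMap.proj (R := ℝ) (φ := fun _ : E => ℝ) e).comp
      (ContinuousLinearMap.snd ℝ (Fin c → ℝ) (E → ℝ))).hasStrictFDerivAt
        (x := (α, ρ))).mul h3⟩
  choose D hD using h1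
  exact ⟨ContinuousLinearMap.pi fun i => ∑ e, m i e • D e, hasStrictFDerivAt_pi.2 fun i =>
    HasStrictFDerivAt.fun_sum fun e _ => (hD e).const_mul (m i e)⟩

theorem differentiableAt_sum_comp (ℓ : E → (Fin c → ℝ) →L[ℝ] ℝ) (b : E → ℝ)
    (m : Fin c → E → ℝ) {g : E → ℝ → ℝ} {g' : E → ℝ}
    {α : Fin c → ℝ} (hg : ∀ e, HasStrictDerivAt (g e) (g' e) (b e + ℓ e α)) (ρ : E → ℝ) :
    DifferentiableAt ℝ (fun α : Fin c → ℝ =>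
        (fun i => ∑ e, m i e * (ρ e * g e (b e + ℓ e α)) : Fin c → ℝ)) α := by
  obtain ⟨D, hD⟩ := exists_hasStrictFDerivAt_sum ℓ b m hg ρ
  exact (HasFDerivAt.comp α (f := fun α => (α, ρ)) hD.hasFDerivAt
    (hasFDerivAt_prodMk_left α ρ)).differentiableAt

theorem volume_hyperplane_eq_zero {f : (Fin c → ℝ) →L[ℝ] ℝ} (hf : f ≠ 0) (x : ℝ) :
    volume {α | f α = x} = 0 := by
  obtain h | ⟨α₀, h₀⟩ := Set.eq_empty_or_nonempty {α | f α = x}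
  · rw [h, measure_empty]
  have hker : LinearMap.ker (f : (Fin c → ℝ) →ₗ[ℝ] ℝ) ≠ ⊤ := by
    rw [Ne, LinearMap.ker_eq_top]
    exact fun h => hf (ContinuousLinearMap.coe_injective h)
  have h1 := Measure.addHaar_submodule volume _ hker
  have h2 : {α | f α = x} ⊆ (fun α => α₀ + α) ''
      (LinearMap.ker (f : (Fin c → ℝ) →ₗ[ℝ] ℝ) : Set (Fin c → ℝ)) := by
    intro α hα
    refine ⟨α - α₀, ?_, by simp⟩
    simp only [Set.mem_ofPred_eq] at hα h₀
    simp [hα, h₀]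
  refine measure_mono_null h2 ?_
  rw [Set.image_add_left, measure_preimage_add]
  exact h1

-- A single equation with `e ∈ S` confines `α` to a hyperplane, and differentiable maps preserve
-- null sets. On `S` the angle is frozen at `t e`, because the sine need not be injective on the
-- closure of `I e`.
open Classical in
theorem volume_image_frontier_stratum (hs : ∀ e, Set.InjOn Real.sin (I e)) (hℓ : ∀ e, ℓ e ≠ 0)
    (r t : E → ℝ) {S : Set E} (hS : S.Nonempty) :
    volume ((fun (α : Fin c → ℝ) (i : Fin c) => ∑ e, m i e * (r e *
      (if e ∈ S then fun _ => t e else Function.invFunOn Real.sin (I e)) (b e + ℓ e α))) ''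
        {α | (∀ e ∈ S, b e + ℓ e α = Real.sin (t e)) ∧
          ∀ e ∉ S, b e + ℓ e α ∈ Real.sin '' interior (I e)}) = 0 := by
  refine addHaar_image_eq_zero_of_differentiableOn_of_addHaar_eq_zero volume ?_ ?_
  · rintro α ⟨-, hα⟩
    have hg : ∀ e, ∃ g', HasStrictDerivAt
        (if e ∈ S then fun _ => t e else Function.invFunOn Real.sin (I e)) g' (b e + ℓ e α) := by
      intro e
      split_ifs with he
      · exact ⟨0, hasStrictDerivAt_const _ _⟩
      · obtain ⟨x, hx, hxe⟩ := hα e he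
        rw [← hxe]
        exact ⟨_, hasStrictDerivAt_invFunOn_sin (hs e) hx⟩
    choose g' hg' using hg
    exact (differentiableAt_sum_comp ℓ b m hg' r).differentiableWithinAt
  · obtain ⟨e, he⟩ := hS
    refine measure_mono_null ?_ (volume_hyperplane_eq_zero (hℓ e) (Real.sin (t e) - b e))
    rintro α ⟨hα, -⟩
    exact eq_sub_of_add_eq' (hα e he)

/-- Sard's theorem in equal dimensions, which needs only differentiability. -/
theorem volume_image_critical (hs : ∀ e, Set.InjOn Real.sin (I e)) (r : E → ℝ) :
    volume ((fun (α : Fin c → ℝ) (i : Fin c) => ∑ e, m i e * (r e *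
      Function.invFunOn Real.sin (I e) (b e + ℓ e α))) ''
        {α | (∀ e, b e + ℓ e α ∈ Real.sin '' interior (I e)) ∧
          (fderiv ℝ (fun (α : Fin c → ℝ) (i : Fin c) => ∑ e, m i e * (r e *
            Function.invFunOn Real.sin (I e) (b e + ℓ e α))) α).det = 0}) = 0 := by
  refine addHaar_image_eq_zero_of_det_fderivWithin_eq_zero volume
    (f' := fderiv ℝ (fun (α : Fin c → ℝ) (i : Fin c) => ∑ e, m i e * (r e *
            Function.invFunOn Real.sin (I e) (b e + ℓ e α)))) ?_ fun α hα => hα.2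
  rintro α ⟨hα, -⟩
  have hg : ∀ e, ∃ g', HasStrictDerivAt (Function.invFunOn Real.sin (I e)) g' (b e + ℓ e α) := by
    intro e
    obtain ⟨x, hx, hxe⟩ := hα e
    rw [← hxe]
    exact ⟨_, hasStrictDerivAt_invFunOn_sin (hs e) hx⟩
  choose g' hg' using hg
  exact (differentiableAt_sum_comp ℓ b m hg' r).hasFDerivAt.hasFDerivWithinAt

theorem mem_stableWindingSet_of_det_ne_zero (hs : ∀ e, Set.InjOn Real.sin (I e)) (r : E → ℝ)
    {α : Fin c → ℝ} (hα : ∀ e, b e + ℓ e α ∈ Real.sin '' interior (I e))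
    (hdet : (fderiv ℝ (fun (α : Fin c → ℝ) (i : Fin c) => ∑ e, m i e * (r e *
            Function.invFunOn Real.sin (I e) (b e + ℓ e α))) α).det ≠ 0) :
    (fun i => ∑ e, m i e * (r e * Function.invFunOn Real.sin (I e) (b e + ℓ e α))) ∈
      stableWindingSet ℓ b m I r := by
  have hg : ∀ e, ∃ g', HasStrictDerivAt (Function.invFunOn Real.sin (I e)) g' (b e + ℓ e α) := by
    intro e
    obtain ⟨x, hx, hxe⟩ := hα e
    rw [← hxe]
    exact ⟨_, hasStrictDerivAt_invFunOn_sin (hs e) hx⟩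
  choose g' hg' using hg
  obtain ⟨D, hD⟩ := exists_hasStrictFDerivAt_sum ℓ b m hg' r
  have hDl := (HasFDerivAt.comp α (f := fun α => (α, r)) hD.hasFDerivAt
    (hasFDerivAt_prodMk_left α r)).fderiv
  have hdet' : (D.comp (ContinuousLinearMap.inl ℝ (Fin c → ℝ) (E → ℝ))).det ≠ 0 := by
    rw [← hDl]
    exact hdet
  have hsurj : Function.Surjective (D.comp (ContinuousLinearMap.inl ℝ (Fin c → ℝ) (E → ℝ))) :=
    ((LinearMap.equivOfDetNeZero _ hdet').surjective :)
  -- Carrying the weights along makes the derivative of `(α, ρ) ↦ (y, ρ)` block triangular, hence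
  -- surjective as soon as its `α`-block is. The map then sends neighbourhoods onto neighbourhoods.
  have hF := hD.prodMk (hasStrictFDerivAt_snd (𝕜 := ℝ) (p := (α, r)))
  have hrange : (D.prod (ContinuousLinearMap.snd ℝ (Fin c → ℝ) (E → ℝ))).range = ⊤ := by
    refine LinearMap.range_eq_top.2 fun p => ?_
    obtain ⟨α', hα'⟩ := hsurj (p.1 - D (0, p.2))
    refine ⟨(α', p.2), Prod.ext ?_ rfl⟩
    have : ((α', p.2) : (Fin c → ℝ) × (E → ℝ)) = (α', 0) + (0, p.2) := by simp
    simp only [ContinuousLinearMap.coe_comp, Function.comp_apply,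
      ContinuousLinearMap.inl_apply] at hα'
    simp only [ContinuousLinearMap.coe_coe, ContinuousLinearMap.prod_apply]
    rw [this, map_add, hα']
    simp
  have hmap := hF.map_nhds_eq_of_surj hrange
  change {p : (Fin c → ℝ) × (E → ℝ) | p.1 ∈ windingSet ℓ b m I p.2} ∈ 𝓝 _
  rw [← hmap, mem_map]
  have hev : ∀ᶠ p : (Fin c → ℝ) × (E → ℝ) in 𝓝 (α, r),
      ∀ e, b e + ℓ e p.1 ∈ Real.sin '' interior (I e) := by
    refine eventually_all.2 fun e => ?_
    obtain ⟨x, hx, hxe⟩ := hα e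
    have hcont : ContinuousAt (fun p : (Fin c → ℝ) × (E → ℝ) => b e + ℓ e p.1) (α, r) := by
      fun_prop
    refine hcont ?_
    change _ ∈ 𝓝 (b e + ℓ e α)
    rw [← hxe]
    exact sin_image_interior_mem_nhds (hs e) hx
  filter_upwards [hev] with p hp
  have hmem : ∀ e, b e + ℓ e p.1 ∈ Real.sin '' I e := fun e =>
    Set.image_mono interior_subset (hp e)
  exact ⟨p.1, fun e => Function.invFunOn Real.sin (I e) (b e + ℓ e p.1),
    fun e => Function.invFunOn_mem (hmem e), fun e => (Function.invFunOn_eq (hmem e)).symm, rfl⟩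

theorem volume_windingSet_closure_diff (hs : ∀ e, Set.InjOn Real.sin (I e))
    (hfr : ∀ e, (frontier (I e)).Finite) (hℓ : ∀ e, ℓ e ≠ 0) (r : E → ℝ) :
    volume (windingSet ℓ b m (fun e => closure (I e)) r \ stableWindingSet ℓ b m I r) = 0 := by
  classical
  have hT : {t : E → ℝ | ∀ e, t e ∈ insert 0 (frontier (I e))}.Finite :=
    Set.Finite.pi' fun e => (hfr e).insert 0
  refine measure_mono_null ?_ (measure_union_null
    ((measure_biUnion_null_iff (Set.toFinite {S : Set E | S.Nonempty}).countable).2 fun S hS =>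
      (measure_biUnion_null_iff hT.countable).2 fun t _ =>
        volume_image_frontier_stratum (m := m) (b := b) hs hℓ r t hS)
    (volume_image_critical (m := m) (b := b) (ℓ := ℓ) hs r))
  rintro y ⟨⟨α, θ, h1, h2, rfl⟩, hy⟩
  have hinv : ∀ e, θ e ∈ interior (I e) →
      Function.invFunOn Real.sin (I e) (b e + ℓ e α) = θ e := fun e he => by
    have hθ : θ e ∈ I e := interior_subset he
    rw [h2 e]
    exact hs e (Function.invFunOn_mem ⟨_, hθ, rfl⟩) hθ (Function.invFunOn_eq ⟨_, hθ, rfl⟩)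
  by_cases hint : ∀ e, θ e ∈ interior (I e)
  · right
    have hα : ∀ e, b e + ℓ e α ∈ Real.sin '' interior (I e) := fun e =>
      ⟨θ e, hint e, (h2 e).symm⟩
    have hval : (fun i => ∑ e, m i e * (r e * Function.invFunOn Real.sin (I e) (b e + ℓ e α))) =
        fun i => ∑ e, m i e * (r e * θ e) := by
      simp only [fun e => hinv e (hint e)]
    refine ⟨α, ⟨hα, ?_⟩, hval⟩
    -- A regular value would be stable, contrary to `hy`.
    by_contra hdet
    exact hy (hval ▸ mem_stableWindingSet_of_det_ne_zero hs r hα hdet)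
  · left
    push Not at hint
    simp only [Set.mem_iUnion]
    -- The stratum is indexed by the edges whose angle is not interior, with these angles as the
    -- frozen values.
    refine ⟨{e | θ e ∉ interior (I e)}, hint,
      fun e => if θ e ∈ interior (I e) then 0 else θ e, fun e => ?_, α, ⟨?_, ?_⟩, ?_⟩
    · by_cases he : θ e ∈ interior (I e)
      · simp [he]
      · simp only [he, if_false]
        exact Or.inr ⟨h1 e, he⟩
    · intro e he
      simp only [Set.mem_ofPred_eq] at he
      simp only [he, if_false]
      exact h2 e
    · intro e he
      simp only [Set.mem_ofPred_eq, not_not] at he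
      exact ⟨θ e, he, (h2 e).symm⟩
    · funext i
      refine Finset.sum_congr rfl fun e _ => ?_
      by_cases he : θ e ∈ interior (I e)
      · simp [he, hinv e he]
      · simp [he]

theorem windingSet_ae_eq_stableWindingSet (hs : ∀ e, Set.InjOn Real.sin (I e))
    (hfr : ∀ e, (frontier (I e)).Finite) (hℓ : ∀ e, ℓ e ≠ 0) (r : E → ℝ) :
    windingSet ℓ b m I r =ᵐ[volume] stableWindingSet ℓ b m I r := by
  refine EventuallyLE.antisymm ?_ (stableWindingSet_subset r).eventuallyLE
  refine ae_le_set.2 (measure_mono_null ?_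
    (volume_windingSet_closure_diff (b := b) (m := m) hs hfr hℓ r))
  exact Set.sdiff_subset_sdiff_left (windingSet_mono (fun e => subset_closure) r)

theorem tendsto_card_windingSet (hs : ∀ e, Set.InjOn Real.sin (I e))
    (hb : ∀ e, Bornology.IsBounded (I e)) (hfr : ∀ e, (frontier (I e)).Finite)
    (hℓ : ∀ e, ℓ e ≠ 0) {r : E → ℝ} {ρ : ℕ → E → ℝ} (hρ : Tendsto ρ atTop (𝓝 r)) :
    Tendsto (fun M : ℕ => ((scaledLatticePoints M (windingSet ℓ b m I (ρ M))).ncard : ℝ) /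
      (M : ℝ) ^ c) atTop (𝓝 (volume (windingSet ℓ b m I r)).toReal) := by
  have hsub := windingSet_mono (ℓ := ℓ) (b := b) (m := m) (fun e => subset_closure (s := I e)) r
  have hnull := volume_windingSet_closure_diff (b := b) (m := m) hs hfr hℓ r
  have hvol : volume (windingSet ℓ b m I r) =
      volume (windingSet ℓ b m (fun e => closure (I e)) r) :=
    measure_congr (hsub.eventuallyLE.antisymm (ae_le_set.2
      (measure_mono_null (Set.sdiff_subset_sdiff_right (stableWindingSet_subset r)) hnull)))
  rw [hvol]
  exact tendsto_card_scaledLatticePoints _ (isCompact_windingSet_closure hb r)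
    (isOpen_stableWindingSet r) ((stableWindingSet_subset r).trans hsub) hnull
    (fun ε hε => hρ.eventually (eventually_windingSet_subset_cthickening hb r hε))
    (fun K hKU hK => hρ.eventually (eventually_subset_windingSet hKU hK))

end

/-! ### Flows, cycles and the Kirchhoff form -/

noncomputable section

namespace Network

variable {V E : Type*}

open Classical in
theorem incidence_mulVec_apply [Fintype E] (G : Network V E) {R : Type*} [Ring R] (x : E → R)
    (i : V) : (G.incidence R).mulVec x i =
      (∑ e, if G.head e = i then x e else 0) - ∑ e, if G.tail e = i then x e else 0 := by
  simp [incidence, Matrix.mulVec, dotProduct, sub_mul, Finset.sum_sub_distrib]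

theorem incidence_mulVec_intCast [Fintype E] (G : Network V E) (z : E → ℤ) (i : V) :
    (G.incidence ℝ).mulVec (fun e => (z e : ℝ)) i = ((G.incidence ℤ).mulVec z i : ℤ) := by
  classical
  rw [incidence_mulVec_apply, incidence_mulVec_apply]
  push_cast
  rfl

open Classical in
theorem incidence_mulVec_single [Fintype E] (G : Network V E) {R : Type*} [Ring R] (e : E) :
    (G.incidence R).mulVec (Pi.single e 1) =
      Pi.single (G.head e) 1 - Pi.single (G.tail e) 1 := by
  rw [Matrix.mulVec_single_one]
  funext i
  simp [incidence, Pi.single_apply, eq_comm]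

-- Each step of a walk contributes its edge with the sign of the direction of travel. The support
-- condition is what makes flows inside a spanning tree available.
open Classical in
theorem exists_incidence_mulVec_eq_of_reachable [Fintype E] (G : Network V E) (R : Type*) [Ring R]
    {H : SimpleGraph V} (hH : H ≤ G.toSimpleGraph) {u w : V} (h : H.Reachable u w) :
    ∃ z : E → R, (∀ e, s(G.tail e, G.head e) ∉ H.edgeSet → z e = 0) ∧
      (G.incidence R).mulVec z = Pi.single w 1 - Pi.single u 1 := by
  obtain ⟨p⟩ := h
  induction p with
  | nil => exact ⟨0, fun _ _ => rfl, by simp⟩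
  | @cons a b d hab p ih =>
    obtain ⟨z, hz, hz'⟩ := ih
    obtain ⟨⟨e, he⟩, -⟩ := (SimpleGraph.fromEdgeSet_adj _).1 (hH hab)
    replace he : s(G.tail e, G.head e) = s(a, b) := he
    have hmem : s(G.tail e, G.head e) ∈ H.edgeSet := by rw [he]; exact hab
    have hsupp : ∀ e', s(G.tail e', G.head e') ∉ H.edgeSet →
        (Pi.single e 1 : E → R) e' = 0 := by
      intro e' he'
      refine Pi.single_eq_of_ne ?_ _
      rintro rfl
      exact he' hmem
    obtain ⟨h1, h2⟩ | ⟨h1, h2⟩ := Sym2.eq_iff.1 he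
    · refine ⟨z + Pi.single e 1, fun e' he' => by simp [hz e' he', hsupp e' he'], ?_⟩
      rw [Matrix.mulVec_add, hz', incidence_mulVec_single, h1, h2]
      abel
    · refine ⟨z - Pi.single e 1, fun e' he' => by simp [hz e' he', hsupp e' he'], ?_⟩
      rw [Matrix.mulVec_sub, hz', incidence_mulVec_single, h1, h2]
      abel

theorem exists_incidence_mulVec_eq [Fintype V] [Fintype E] (G : Network V E)
    (hG : G.toSimpleGraph.Connected) {ω : V → ℝ} (hω : ∑ i, ω i = 0) :
    ∃ f, (G.incidence ℝ).mulVec f = ω := by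
  classical
  obtain ⟨i₀⟩ := hG.nonempty
  have h := fun i => G.exists_incidence_mulVec_eq_of_reachable ℝ le_rfl (hG.preconnected i₀ i)
  choose z _ hz using h
  -- Each `ω i` is sent from the root `i₀` to `i`; at the root the total sent out is `∑ ω i = 0`.
  refine ⟨∑ i, ω i • z i, ?_⟩
  rw [Matrix.mulVec_sum]
  simp only [Matrix.mulVec_smul, hz, smul_sub, Finset.sum_sub_distrib, ← Finset.sum_smul, hω,
    zero_smul, sub_zero]
  funext j
  simp [Pi.single_apply]

theorem mem_cycleSpace [Fintype V] [Fintype E] {G : Network V E} {z : E → ℤ} :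
    z ∈ G.cycleSpace ↔ (G.incidence ℤ).mulVec z = 0 := by
  simp [cycleSpace]

variable [Fintype V] [Fintype E]

/-- The fundamental cycle of `e` with respect to `T` has coefficient `1` at `e`, so the basis
vectors cannot all vanish there. -/
theorem exists_basis_apply_ne_zero (G : Network V E) {c : ℕ}
    (v : Module.Basis (Fin c) ℤ G.cycleSpace) {T : SimpleGraph V} (hT : T ≤ G.toSimpleGraph)
    (hconn : T.Connected) {e : E} (he : s(G.tail e, G.head e) ∉ T.edgeSet) :
    ∃ i, (v i : E → ℤ) e ≠ 0 := by
  classical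
  obtain ⟨z, hz, hz'⟩ := G.exists_incidence_mulVec_eq_of_reachable ℤ hT
    (hconn.preconnected (G.tail e) (G.head e))
  have hmem : Pi.single e 1 - z ∈ G.cycleSpace := by
    rw [mem_cycleSpace, Matrix.mulVec_sub, hz', incidence_mulVec_single, sub_self]
  by_contra! h
  have h1 := congrArg (fun x : G.cycleSpace => (x : E → ℤ) e)
    (v.sum_repr ⟨Pi.single e 1 - z, hmem⟩)
  simp only [AddSubmonoidClass.coe_finsetSum, Finset.sum_apply, Submodule.coe_smul,
    Pi.smul_apply, h, smul_zero, Finset.sum_const_zero, Pi.sub_apply, Pi.single_eq_same,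
    hz e he, sub_zero] at h1
  exact zero_ne_one h1

/-- An integral basis of the cycle space spans the real kernel of the incidence matrix. -/
theorem exists_eq_sum_basis (G : Network V E) {c : ℕ} (v : Module.Basis (Fin c) ℤ G.cycleSpace)
    {x : E → ℝ} (hx : (G.incidence ℝ).mulVec x = 0) :
    ∃ α : Fin c → ℝ, ∀ e, x e = ∑ i, α i * ((v i : E → ℤ) e : ℝ) := by
  classical
  -- The entries of `x` generate a finitely generated torsion-free, hence free, subgroup of `ℝ`. The
  -- balance equations have integer coefficients, so each coordinate of `x` with respect to a basis
  -- of it is an integral cycle.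
  let H : Submodule ℤ ℝ := Submodule.span ℤ (Set.range x)
  have : Module.Finite ℤ H := Module.Finite.span_of_finite ℤ (Set.finite_range x)
  have : Module.Free ℤ H := inferInstance
  let β := Module.Free.chooseBasis ℤ H
  let ξ : E → H := fun e => ⟨x e, Submodule.subset_span ⟨e, rfl⟩⟩
  have hξ : ∀ j, (fun e => β.coord j (ξ e)) ∈ G.cycleSpace := by
    intro j
    rw [mem_cycleSpace]
    funext i
    have h1 : (∑ e, if G.head e = i then ξ e else 0) - (∑ e, if G.tail e = i then ξ e else 0)
        = 0 := by
      have := congrFun hx i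
      rw [incidence_mulVec_apply] at this
      apply Subtype.ext
      push_cast [apply_ite Subtype.val]
      simpa [ξ, apply_ite] using this
    have h2 := congrArg (β.coord j) h1
    rw [incidence_mulVec_apply]
    rw [Pi.zero_apply]
    simpa only [map_sub, map_sum, apply_ite (β.coord j), map_zero] using h2
  refine ⟨fun i => ∑ j, (v.repr ⟨_, hξ j⟩ i : ℝ) * (β j : ℝ), fun e => ?_⟩
  have h3 : ∀ j, (β.coord j (ξ e) : ℝ) =
      ∑ i, (v.repr ⟨_, hξ j⟩ i : ℝ) * ((v i : E → ℤ) e : ℝ) := by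
    intro j
    have := congrArg (fun x : G.cycleSpace => ((x : E → ℤ) e : ℝ)) (v.sum_repr ⟨_, hξ j⟩)
    simp only [AddSubmonoidClass.coe_finsetSum, Finset.sum_apply] at this
    rw [← this]
    simp
  have h4 := congrArg (fun x : H => (x : ℝ)) (β.sum_repr (ξ e))
  simp only [AddSubmonoidClass.coe_finsetSum] at h4
  change _ = x e at h4
  rw [← h4]
  simp only [Finset.sum_mul]
  rw [Finset.sum_comm]
  refine Finset.sum_congr rfl fun j _ => ?_
  have h5 : ((β.repr (ξ e) j • β j : H) : ℝ) = (β.coord j (ξ e) : ℝ) * (β j : ℝ) := by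
    simp
  rw [h5, h3, Finset.sum_mul]
  exact Finset.sum_congr rfl fun i _ => by ring

/-- For `ω` in the range, the pseudoinverse gives a particular flow and the cycles span the
homogeneous ones. This removes both the pseudoinverse and the basis from the constraint. -/
theorem exists_L_eq_iff (G : Network V E) (hγ : ∀ e, G.γ e ≠ 0)
    (hω : ∃ f, (G.incidence ℝ).mulVec f = G.ω) {c : ℕ}
    (v : Module.Basis (Fin c) ℤ G.cycleSpace) (x : E → ℝ) :
    (∃ α, ∀ e, G.L v α e = x e) ↔ (G.incidence ℝ).mulVec (fun e => G.γ e * x e) = G.ω := by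
  have hpinv : (G.incidence ℝ).mulVec ((pseudoinverse (G.incidence ℝ)).mulVec G.ω) = G.ω := by
    obtain ⟨f, hf⟩ := hω
    rw [← hf, Matrix.mulVec_mulVec, Matrix.mulVec_mulVec,
      (pseudoinverse_spec (G.incidence ℝ)).mul_mul_self]
  have hL : ∀ α e, G.γ e * G.L v α e = (pseudoinverse (G.incidence ℝ)).mulVec G.ω e +
      ∑ i, α i * ((v i : E → ℤ) e : ℝ) := by
    intro α e
    rw [L, mul_add, mul_inv_cancel_left₀ (hγ e), Finset.mul_sum]
    congr 1
    refine Finset.sum_congr rfl fun i _ => ?_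
    rw [mul_left_comm, mul_inv_cancel_left₀ (hγ e)]
  constructor
  · rintro ⟨α, hα⟩
    have h1 : (fun e => G.γ e * x e) = (pseudoinverse (G.incidence ℝ)).mulVec G.ω +
        ∑ i, α i • fun e => ((v i : E → ℤ) e : ℝ) := by
      funext e
      simp [← hα e, hL, Finset.sum_apply]
    have h2 : ∀ i, (G.incidence ℝ).mulVec (fun e => ((v i : E → ℤ) e : ℝ)) = 0 := by
      intro i
      funext j
      rw [incidence_mulVec_intCast, mem_cycleSpace.1 (v i).2]
      simp
    rw [h1, Matrix.mulVec_add, hpinv, Matrix.mulVec_sum]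
    simp [Matrix.mulVec_smul, h2]
  · intro h
    have h1 : (G.incidence ℝ).mulVec ((fun e => G.γ e * x e) -
        (pseudoinverse (G.incidence ℝ)).mulVec G.ω) = 0 := by
      rw [Matrix.mulVec_sub, h, hpinv, sub_self]
    obtain ⟨α, hα⟩ := G.exists_eq_sum_basis v h1
    refine ⟨α, fun e => mul_left_cancel₀ (hγ e) ?_⟩
    rw [hL, ← hα e]
    simp

theorem mem_Wr_image_A_iff (G : Network V E) (hsin : ∀ e, Set.InjOn Real.sin (G.I e)) {c : ℕ}
    (v : Module.Basis (Fin c) ℤ G.cycleSpace) (r : E → ℝ) (y : Fin c → ℝ) :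
    y ∈ G.Wr v r '' G.A v ↔ ∃ (α : Fin c → ℝ) (θ : E → ℝ), (∀ e, θ e ∈ G.I e) ∧
      (∀ e, G.L v α e = Real.sin (θ e)) ∧
      y = fun i => 1 / (2 * Real.pi) * ∑ e, ((v i : E → ℤ) e : ℝ) * (r e * θ e) := by
  constructor
  · rintro ⟨α, hα, rfl⟩
    exact ⟨α, G.arcsin (G.L v α), fun e => Function.invFunOn_mem (hα e),
      fun e => (Function.invFunOn_eq (hα e)).symm, rfl⟩
  · rintro ⟨α, θ, h1, h2, rfl⟩
    have hα : α ∈ G.A v := fun e => ⟨θ e, h1 e, (h2 e).symm⟩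
    have hθ : G.arcsin (G.L v α) = θ := funext fun e =>
      hsin e (Function.invFunOn_mem (hα e)) (h1 e)
        ((Function.invFunOn_eq (hα e)).trans (h2 e))
    exact ⟨α, hα, by unfold Wr; rw [hθ]⟩

theorem mem_Wr_image_A_iff_incidence (G : Network V E) (hsin : ∀ e, Set.InjOn Real.sin (G.I e))
    (hγ : ∀ e, G.γ e ≠ 0) (hω : ∃ f, (G.incidence ℝ).mulVec f = G.ω) {c : ℕ}
    (v : Module.Basis (Fin c) ℤ G.cycleSpace) (r : E → ℝ) (y : Fin c → ℝ) :
    y ∈ G.Wr v r '' G.A v ↔ ∃ θ : E → ℝ, (∀ e, θ e ∈ G.I e) ∧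
      (G.incidence ℝ).mulVec (fun e => G.γ e * Real.sin (θ e)) = G.ω ∧
      y = fun i => 1 / (2 * Real.pi) * ∑ e, ((v i : E → ℤ) e : ℝ) * (r e * θ e) := by
  rw [mem_Wr_image_A_iff G hsin]
  constructor
  · rintro ⟨α, θ, h1, h2, h3⟩
    exact ⟨θ, h1, (G.exists_L_eq_iff hγ hω v _).1 ⟨α, h2⟩, h3⟩
  · rintro ⟨θ, h1, h2, h3⟩
    obtain ⟨α, hα⟩ := (G.exists_L_eq_iff hγ hω v _).2 h2
    exact ⟨α, θ, h1, hα, h3⟩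

theorem Wr_image_A_eq_windingSet (G : Network V E) (hsin : ∀ e, Set.InjOn Real.sin (G.I e))
    {c : ℕ} (v : Module.Basis (Fin c) ℤ G.cycleSpace) (r : E → ℝ) :
    G.Wr v r '' G.A v = windingSet
      (fun e => ∑ i, ((G.γ e)⁻¹ * ((v i : E → ℤ) e : ℝ)) •
        ContinuousLinearMap.proj (R := ℝ) (φ := fun _ : Fin c => ℝ) i)
      (fun e => (G.γ e)⁻¹ * (pseudoinverse (G.incidence ℝ)).mulVec G.ω e)
      (fun i e => 1 / (2 * Real.pi) * ((v i : E → ℤ) e : ℝ)) G.I r := by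
  ext y
  rw [mem_Wr_image_A_iff G hsin]
  simp [windingSet, L, Finset.mul_sum, mul_assoc, mul_comm, mul_left_comm]

theorem W_eq_Wr_one (G : Network V E) {c : ℕ} (v : Module.Basis (Fin c) ℤ G.cycleSpace) :
    G.W v = G.Wr v 1 := by
  funext α i
  simp [W, Wr]

/-- The number of integral points in the image does not depend on the basis. -/
theorem ncard_Wr_image_A_inter_integerLattice_eq (G : Network V E)
    (hsin : ∀ e, Set.InjOn Real.sin (G.I e))
    (hγ : ∀ e, G.γ e ≠ 0) (hω : ∃ f, (G.incidence ℝ).mulVec f = G.ω) {c : ℕ}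
    (v u : Module.Basis (Fin c) ℤ G.cycleSpace) (r : E → ℝ) :
    (G.Wr u r '' G.A u ∩ integerLattice c).ncard =
      (G.Wr v r '' G.A v ∩ integerLattice c).ncard := by
  -- Integral points correspond to integer-valued functionals on the cycle space, a description free
  -- of any basis.
  let Λ : Set (G.cycleSpace →ₗ[ℤ] ℤ) := {φ | ∃ θ : E → ℝ, (∀ e, θ e ∈ G.I e) ∧
      (G.incidence ℝ).mulVec (fun e => G.γ e * Real.sin (θ e)) = G.ω ∧
      ∀ z : G.cycleSpace, (φ z : ℝ) =
        1 / (2 * Real.pi) * ∑ e, ((z : E → ℤ) e : ℝ) * (r e * θ e)}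
  have key : ∀ v : Module.Basis (Fin c) ℤ G.cycleSpace,
      (G.Wr v r '' G.A v ∩ integerLattice c).ncard = Λ.ncard := by
    intro v
    have hinj : Function.Injective
        (fun (φ : G.cycleSpace →ₗ[ℤ] ℤ) (i : Fin c) => (φ (v i) : ℝ)) := by
      intro φ ψ h
      exact v.ext fun i => Int.cast_injective (α := ℝ) (congrFun h i)
    rw [← Set.ncard_image_of_injective Λ hinj]
    congr 1
    ext y
    rw [Set.mem_inter_iff, mem_Wr_image_A_iff_incidence G hsin hγ hω]
    constructor
    · rintro ⟨⟨θ, h1, h2, rfl⟩, k, hk⟩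
      let ψ : G.cycleSpace →+ ℝ :=
        { toFun := fun z => 1 / (2 * Real.pi) * ∑ e, ((z : E → ℤ) e : ℝ) * (r e * θ e)
          map_zero' := by simp
          map_add' := fun a b => by
            simp [add_mul, Finset.sum_add_distrib, mul_add] }
      -- A real functional with integer values on a basis is integer-valued everywhere.
      have hψ : ((Int.castAddHom ℝ).toIntLinearMap ∘ₗ v.constr ℤ k : G.cycleSpace →ₗ[ℤ] ℝ) =
          ψ.toIntLinearMap := by
        refine v.ext fun i => ?_
        have := congrFun hk i
        simpa [ψ] using this
      refine ⟨v.constr ℤ k, ⟨θ, h1, h2, fun z => ?_⟩, ?_⟩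
      · exact LinearMap.congr_fun hψ z
      · rw [← hk]
        simp
    · rintro ⟨φ, ⟨θ, h1, h2, h3⟩, rfl⟩
      exact ⟨⟨θ, h1, h2, funext fun i => h3 (v i)⟩, fun i => φ (v i), rfl⟩
  rw [key u, key v]

end Network

end

/-! ### Subdivisions -/

noncomputable section

namespace Network

variable {V E : Type*}

theorem pathVertex_eq_inr_iff (G : Network V E) (n : E → ℕ) (e' : E) (k : ℕ) (e : E)
    (j : Fin (n e - 1)) : G.pathVertex n e' k = Sum.inr ⟨e, j⟩ ↔ e' = e ∧ k = j + 1 := by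
  unfold pathVertex
  split_ifs with h1 h2
  · simp [h1]
  · simp only [Sum.inr.injEq, Sigma.mk.injEq]
    constructor
    · rintro ⟨rfl, h⟩
      have := eq_of_heq h
      refine ⟨rfl, ?_⟩
      rw [← this]
      simp only
      omega
    · rintro ⟨rfl, rfl⟩
      exact ⟨rfl, heq_of_eq (Fin.ext (by simp))⟩
  · simp only [false_iff, not_and]
    rintro rfl h
    have := j.2
    omega

theorem pathVertex_eq_inl_iff (G : Network V E) (n : E → ℕ) (e : E) {k : ℕ} (hk : k < n e)
    (i : V) : G.pathVertex n e k = Sum.inl i ↔ k = 0 ∧ G.tail e = i := by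
  unfold pathVertex
  split_ifs with h1 h2
  · simp [h1]
  · simp [h1]
  · omega

theorem pathVertex_succ_eq_inl_iff (G : Network V E) (n : E → ℕ) (e : E) {k : ℕ} (hk : k < n e)
    (i : V) : G.pathVertex n e (k + 1) = Sum.inl i ↔ k = n e - 1 ∧ G.head e = i := by
  rw [pathVertex, if_neg (Nat.succ_ne_zero k)]
  split_ifs with h
  · simp only [false_iff, not_and]
    omega
  · have : k = n e - 1 := by omega
    simp [this]

variable [Fintype E] {R : Type*} [Ring R]

/-- The new vertex `j` sits at position `j + 1` of its path, so the path edge `j` enters it, the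
path edge `j + 1` leaves it, and no other edge touches it. -/
theorem subdivide_incidence_mulVec_inr (G : Network V E) (n : E → ℕ)
    (x : (Σ e : E, Fin (n e)) → R) (e : E) (j : Fin (n e - 1)) :
    ((G.subdivide n).incidence R).mulVec x (Sum.inr ⟨e, j⟩) =
      x ⟨e, ⟨j, by omega⟩⟩ - x ⟨e, ⟨j + 1, by omega⟩⟩ := by
  classical
  rw [incidence_mulVec_apply]
  simp only [subdivide, pathVertex_eq_inr_iff]
  congr 1
  · rw [Finset.sum_eq_single (⟨e, ⟨j, by omega⟩⟩ : Σ e : E, Fin (n e))]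
    · simp
    · rintro ⟨e', k⟩ - hne
      refine if_neg fun h => hne ?_
      obtain ⟨rfl, h⟩ := h
      congr 1
      exact Fin.ext (by simpa using h)
    · simp
  · rw [Finset.sum_eq_single (⟨e, ⟨j + 1, by omega⟩⟩ : Σ e : E, Fin (n e))]
    · simp
    · rintro ⟨e', k⟩ - hne
      refine if_neg fun h => hne ?_
      obtain ⟨rfl, h⟩ := h
      congr 1
      exact Fin.ext (by simpa using h)
    · simp

theorem subdivide_incidence_mulVec_inl (G : Network V E) {n : E → ℕ} (hn : ∀ e, 1 ≤ n e)
    (z : E → R) (i : V) :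
    ((G.subdivide n).incidence R).mulVec (fun e' => z e'.1) (Sum.inl i) =
      (G.incidence R).mulVec z i := by
  classical
  rw [incidence_mulVec_apply, incidence_mulVec_apply, Fintype.sum_sigma, Fintype.sum_sigma]
  simp only [subdivide, pathVertex_eq_inl_iff, pathVertex_succ_eq_inl_iff, Fin.is_lt]
  congr 1
  · refine Finset.sum_congr rfl fun e _ => ?_
    -- Only the last edge of a path enters the old head, and below only the first leaves the old
    -- tail.
    rw [Finset.sum_eq_single (⟨n e - 1, by have := hn e; omega⟩ : Fin (n e))]
    · simp
    · intro k _ hne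
      exact if_neg fun h => hne (Fin.ext h.1)
    · simp
  · refine Finset.sum_congr rfl fun e _ => ?_
    rw [Finset.sum_eq_single (⟨0, hn e⟩ : Fin (n e))]
    · simp
    · intro k _ hne
      exact if_neg fun h => hne (Fin.ext h.1)
    · simp

/-- The flows on a subdivision are the flows on the graph, repeated along the paths. -/
theorem subdivide_incidence_mulVec_eq_iff (G : Network V E) {n : E → ℕ} (hn : ∀ e, 1 ≤ n e)
    (x : (Σ e : E, Fin (n e)) → R) (ω : V → R) :
    ((G.subdivide n).incidence R).mulVec x = Sum.elim ω (fun _ => 0) ↔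
      ∃ z : E → R, (∀ e k, x ⟨e, k⟩ = z e) ∧ (G.incidence R).mulVec z = ω := by
  constructor
  · intro h
    have hconst : ∀ e k (hk : k < n e), x ⟨e, ⟨k, hk⟩⟩ = x ⟨e, ⟨0, hn e⟩⟩ := by
      intro e k
      induction k with
      | zero => exact fun _ => rfl
      | succ k ih =>
        intro hk
        have h1 := congrFun h (Sum.inr ⟨e, ⟨k, by omega⟩⟩)
        rw [subdivide_incidence_mulVec_inr, Sum.elim_inr, sub_eq_zero] at h1
        rw [← ih (by omega), h1]
    have hx : x = fun e' : (Σ e : E, Fin (n e)) => x ⟨e'.1, ⟨0, hn e'.1⟩⟩ :=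
      funext fun e' => hconst e'.1 e'.2 e'.2.2
    refine ⟨fun e => x ⟨e, ⟨0, hn e⟩⟩, fun e k => hconst e k k.2, funext fun i => ?_⟩
    rw [← subdivide_incidence_mulVec_inl G hn, ← hx, h, Sum.elim_inl]
  · rintro ⟨z, hz, rfl⟩
    have hx : x = fun e' => z e'.1 := funext fun ⟨e, k⟩ => hz e k
    funext i
    obtain i | ⟨e, j⟩ := i
    · rw [hx, subdivide_incidence_mulVec_inl G hn, Sum.elim_inl]
    · rw [subdivide_incidence_mulVec_inr, hz, hz, sub_self, Sum.elim_inr]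

variable [Fintype V]

/-- Repeating the values of a cycle along the paths of a subdivision. -/
def subdivideCycleMap (G : Network V E) {n : E → ℕ} (hn : ∀ e, 1 ≤ n e) :
    G.cycleSpace →ₗ[ℤ] (G.subdivide n).cycleSpace where
  toFun z := ⟨fun e' => (z : E → ℤ) e'.1, mem_cycleSpace.2
    (((subdivide_incidence_mulVec_eq_iff G hn _ 0).2
      ⟨z, fun _ _ => rfl, mem_cycleSpace.1 z.2⟩).trans Sum.elim_zero_zero)⟩
  map_add' _ _ := rfl
  map_smul' _ _ := rfl

theorem bijective_subdivideCycleMap (G : Network V E) {n : E → ℕ} (hn : ∀ e, 1 ≤ n e) :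
    Function.Bijective (G.subdivideCycleMap hn) := by
  constructor
  · intro a b h
    refine Subtype.ext (funext fun e => ?_)
    exact congrFun (congrArg Subtype.val h) ⟨e, ⟨0, hn e⟩⟩
  · intro x
    obtain ⟨z, hz, hz'⟩ := (subdivide_incidence_mulVec_eq_iff G hn (x : _ → ℤ) 0).1
      ((mem_cycleSpace.1 x.2).trans Sum.elim_zero_zero.symm)
    exact ⟨⟨z, mem_cycleSpace.2 hz'⟩, Subtype.ext (funext fun e' => (hz e'.1 e'.2).symm)⟩

/-- The cycle space of a subdivision. -/
def subdivideCycleEquiv (G : Network V E) {n : E → ℕ} (hn : ∀ e, 1 ≤ n e) :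
    G.cycleSpace ≃ₗ[ℤ] (G.subdivide n).cycleSpace :=
  LinearEquiv.ofBijective (G.subdivideCycleMap hn) (G.bijective_subdivideCycleMap hn)

theorem subdivideCycleEquiv_apply (G : Network V E) {n : E → ℕ} (hn : ∀ e, 1 ≤ n e)
    (z : G.cycleSpace) (e' : Σ e : E, Fin (n e)) :
    (G.subdivideCycleEquiv hn z : (Σ e : E, Fin (n e)) → ℤ) e' = (z : E → ℤ) e'.1 := rfl

theorem subdivide_W_image_A (G : Network V E) (hsin : ∀ e, Set.InjOn Real.sin (G.I e))
    (hγ : ∀ e, G.γ e ≠ 0) (hω : ∃ f, (G.incidence ℝ).mulVec f = G.ω) {c : ℕ}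
    {n : E → ℕ} (hn : ∀ e, 1 ≤ n e) (w : Module.Basis (Fin c) ℤ (G.subdivide n).cycleSpace) :
    (G.subdivide n).W w '' (G.subdivide n).A w =
      G.Wr (w.map (G.subdivideCycleEquiv hn).symm) (fun e => (n e : ℝ)) ''
        G.A (w.map (G.subdivideCycleEquiv hn).symm) := by
  have hω' : ∃ f, ((G.subdivide n).incidence ℝ).mulVec f = (G.subdivide n).ω := by
    obtain ⟨f, hf⟩ := hω
    exact ⟨fun e' => f e'.1,
      (subdivide_incidence_mulVec_eq_iff G hn _ G.ω).2 ⟨f, fun _ _ => rfl, hf⟩⟩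
  have hw : ∀ i e k, (w i : (Σ e : E, Fin (n e)) → ℤ) ⟨e, k⟩ =
      (w.map (G.subdivideCycleEquiv hn).symm i : E → ℤ) e := by
    intro i e k
    rw [← G.subdivideCycleEquiv_apply hn _ ⟨e, k⟩, Module.Basis.map_apply,
      LinearEquiv.apply_symm_apply]
  have hsum : ∀ (θ : E → ℝ) i,
      ∑ e' : Σ e : E, Fin (n e), ((w i : (Σ e : E, Fin (n e)) → ℤ) e' : ℝ) * θ e'.1 =
      ∑ e, ((w.map (G.subdivideCycleEquiv hn).symm i : E → ℤ) e : ℝ) * (n e * θ e) := by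
    intro θ i
    rw [Fintype.sum_sigma]
    refine Finset.sum_congr rfl fun e _ => ?_
    simp only [hw, Finset.sum_const, Finset.card_univ, Fintype.card_fin, nsmul_eq_mul]
    ring
  ext y
  rw [W_eq_Wr_one, mem_Wr_image_A_iff_incidence (G.subdivide n) (fun e' => hsin e'.1)
    (fun e' => hγ e'.1) hω', mem_Wr_image_A_iff_incidence G hsin hγ hω]
  simp only [Pi.one_apply, one_mul]
  constructor
  · rintro ⟨θ, h1, h2, rfl⟩
    obtain ⟨z, hz, hz'⟩ := (subdivide_incidence_mulVec_eq_iff G hn _ G.ω).1 h2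
    -- Balance makes `γ e * sin θ` constant along the path; `γ e ≠ 0` and injectivity of the sine on
    -- `I e` then fix the angle. The path thus contributes `n e` copies of one angle.
    have hθ : ∀ e', θ e' = θ ⟨e'.1, ⟨0, hn e'.1⟩⟩ := by
      rintro ⟨e, k⟩
      refine hsin e (h1 ⟨e, k⟩) (h1 ⟨e, ⟨0, hn e⟩⟩) (mul_left_cancel₀ (hγ e) ?_)
      exact (hz e k).trans (hz e _).symm
    refine ⟨fun e => θ ⟨e, ⟨0, hn e⟩⟩, fun e => h1 ⟨e, ⟨0, hn e⟩⟩, ?_, ?_⟩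
    · rw [← hz']
      congr 1
      exact funext fun e => hz e _
    · funext i
      rw [← hsum]
      simp only [← hθ]
  · rintro ⟨θ, h1, h2, rfl⟩
    refine ⟨fun e' => θ e'.1, fun e' => h1 e'.1, ?_, ?_⟩
    · exact (subdivide_incidence_mulVec_eq_iff G hn _ G.ω).2
        ⟨fun e => G.γ e * Real.sin (θ e), fun _ _ => rfl, h2⟩
    · funext i
      rw [← hsum]

end Network

/-! ### Rescaling and conclusion -/

theorem inter_integerLattice_eq_image {c : ℕ} (Y : Set (Fin c → ℝ)) :
    Y ∩ integerLattice c = (fun (k : Fin c → ℤ) i => (k i : ℝ)) '' scaledLatticePoints 1 Y := by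
  ext y
  simp only [integerLattice, scaledLatticePoints, Nat.cast_one, div_one, Set.mem_inter_iff,
    Set.mem_range, Set.mem_image, Set.mem_ofPred_eq]
  constructor
  · rintro ⟨hy, k, rfl⟩
    exact ⟨k, hy, rfl⟩
  · rintro ⟨k, hk, rfl⟩
    exact ⟨hk, k, rfl⟩

theorem ncard_inter_integerLattice {c : ℕ} (Y : Set (Fin c → ℝ)) :
    (Y ∩ integerLattice c).ncard = (scaledLatticePoints 1 Y).ncard := by
  rw [inter_integerLattice_eq_image, Set.ncard_image_of_injective]
  exact fun k l h => funext fun i => Int.cast_injective (α := ℝ) (congrFun h i)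

theorem finite_inter_integerLattice {c : ℕ} {Y : Set (Fin c → ℝ)} (hY : Bornology.IsBounded Y) :
    (Y ∩ integerLattice c).Finite := by
  rw [inter_integerLattice_eq_image]
  exact (finite_scaledLatticePoints one_pos hY).image _

/-- The values are linear in the weights, while the constraint on the angles does not involve them.
-/
theorem scaledLatticePoints_windingSet_div {E : Type*} [Fintype E] {c : ℕ}
    (ℓ : E → (Fin c → ℝ) →L[ℝ] ℝ) (b : E → ℝ) (m : Fin c → E → ℝ) (I : E → Set ℝ)
    (ρ : E → ℝ) {M : ℕ} (hM : 0 < M) :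
    scaledLatticePoints M (windingSet ℓ b m I fun e => ρ e / M) =
      scaledLatticePoints 1 (windingSet ℓ b m I ρ) := by
  have hM' : (M : ℝ) ≠ 0 := by exact_mod_cast hM.ne'
  have h : ∀ (θ : E → ℝ) i, ∑ e, m i e * (ρ e / M * θ e) = (∑ e, m i e * (ρ e * θ e)) / M := by
    intro θ i
    rw [Finset.sum_div]
    exact Finset.sum_congr rfl fun e _ => by ring
  ext k
  simp only [scaledLatticePoints, windingSet, Set.mem_ofPred_eq, h, funext_iff, Nat.cast_one,
    div_one, div_left_inj' hM']

end

theorem theorem3 {V E : Type*} [Fintype V] [Fintype E] (G : Network V E)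
    (hsimple : G.IsSimple) (hconn : G.toSimpleGraph.Connected)
    (htree : ∀ e, ∃ T : SimpleGraph V, T ≤ G.toSimpleGraph ∧ T.IsTree ∧
      s(G.tail e, G.head e) ∉ T.edgeSet)
    (hγ : ∀ e, G.γ e ≠ 0)
    (hω : ∑ i, G.ω i = 0)
    (hsin : ∀ e, Set.InjOn Real.sin (G.I e))
    (hI : ∀ e, IsFiniteUnionOfIntervals (G.I e))
    {c : ℕ} (v : Module.Basis (Fin c) ℤ G.cycleSpace)
    (r : E → ℝ) (hr : ∀ e, 0 < r e)
    (n : ℕ → E → ℕ) (hn : ∀ M e, 1 ≤ n M e)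
    (hnr : ∀ e, (fun M : ℕ => (n M e : ℝ) - r e * (M : ℝ)) =o[atTop] fun M : ℕ => (M : ℝ))
    (w : ∀ M, Module.Basis (Fin c) ℤ (G.subdivide (n M)).cycleSpace) :
    NullMeasurableSet (G.Wr v r '' G.A v) volume ∧
    volume (G.Wr v r '' G.A v) ≠ ⊤ ∧
    (∀ M, ((G.subdivide (n M)).W (w M) '' (G.subdivide (n M)).A (w M)
      ∩ integerLattice c).Finite) ∧
    Tendsto (fun M : ℕ =>
        (((G.subdivide (n M)).W (w M) '' (G.subdivide (n M)).A (w M)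
          ∩ integerLattice c).ncard : ℝ) / (M : ℝ) ^ c)
      atTop (𝓝 (volume (G.Wr v r '' G.A v)).toReal) ∧
    ((∀ e, r e = 1) →
      Tendsto (fun M : ℕ =>
          (((G.subdivide (n M)).W (w M) '' (G.subdivide (n M)).A (w M)
            ∩ integerLattice c).ncard : ℝ) / (M : ℝ) ^ c)
        atTop (𝓝 (volume (G.W v '' G.A v)).toReal)) := by
  have hrange := G.exists_incidence_mulVec_eq hconn hω
  have hb : ∀ e, Bornology.IsBounded (G.I e) := fun e => (hI e).isBounded_of_injOn_sin (hsin e)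
  have hfr : ∀ e, (frontier (G.I e)).Finite := fun e => (hI e).finite_frontier (hb e)
  have hbdd : ∀ (u : Module.Basis (Fin c) ℤ G.cycleSpace) ρ,
      ∃ K, IsCompact K ∧ G.Wr u ρ '' G.A u ⊆ K := by
    intro u ρ
    rw [G.Wr_image_A_eq_windingSet hsin]
    exact ⟨_, isCompact_windingSet_closure hb ρ, windingSet_mono (fun e => subset_closure) ρ⟩
  -- This is where the spanning tree avoiding `e` enters: some basis cycle passes through `e`.
  have hℓ : ∀ e, (∑ i, ((G.γ e)⁻¹ * ((v i : E → ℤ) e : ℝ)) •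
      ContinuousLinearMap.proj (R := ℝ) (φ := fun _ : Fin c => ℝ) i) ≠ 0 := by
    intro e h
    obtain ⟨T, hT, hTree, he⟩ := htree e
    obtain ⟨i, hi⟩ := G.exists_basis_apply_ne_zero v hT hTree.connected he
    have h1 := DFunLike.congr_fun h (Pi.single i 1)
    simp [Pi.single_apply, hγ e, hi] at h1
  have hnM : Tendsto (fun (M : ℕ) (e : E) => (n M e : ℝ) / M) atTop (𝓝 r) := by
    refine tendsto_pi_nhds.2 fun e => ?_
    have h1 := ((hnr e).tendsto_div_nhds_zero).add_const (r e)
    rw [zero_add] at h1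
    refine h1.congr' ?_
    filter_upwards [eventually_gt_atTop 0] with M hM
    have hM' : (M : ℝ) ≠ 0 := by exact_mod_cast hM.ne'
    field_simp
    ring
  have hlim : Tendsto (fun M : ℕ =>
        (((G.subdivide (n M)).W (w M) '' (G.subdivide (n M)).A (w M)
          ∩ integerLattice c).ncard : ℝ) / (M : ℝ) ^ c)
      atTop (𝓝 (volume (G.Wr v r '' G.A v)).toReal) := by
    rw [G.Wr_image_A_eq_windingSet hsin]
    -- The weights `n M e / M` converge to `r`. For `M > 0` the count is transferred from the
    -- subdivision to `G`, then from the transported basis to `v`, then rescaled by `M`.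
    refine (tendsto_card_windingSet hsin hb hfr hℓ hnM).congr' ?_
    filter_upwards [eventually_gt_atTop 0] with M hM
    rw [G.subdivide_W_image_A hsin hγ hrange (hn M),
      G.ncard_Wr_image_A_inter_integerLattice_eq hsin hγ hrange v,
      ncard_inter_integerLattice, G.Wr_image_A_eq_windingSet hsin,
      scaledLatticePoints_windingSet_div _ _ _ _ _ hM]
  refine ⟨?_, ?_, fun M => ?_, hlim, fun h1 => ?_⟩
  · rw [G.Wr_image_A_eq_windingSet hsin]
    -- The image differs from an open set by a null set.
    exact (isOpen_stableWindingSet r).measurableSet.nullMeasurableSet.congr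
      (windingSet_ae_eq_stableWindingSet hsin hfr hℓ r).symm
  · obtain ⟨K, hK, hsub⟩ := hbdd v r
    exact measure_ne_top_of_subset hsub hK.measure_ne_top
  · rw [G.subdivide_W_image_A hsin hγ hrange (hn M)]
    obtain ⟨K, hK, hsub⟩ := hbdd _ _
    exact finite_inter_integerLattice (hK.isBounded.subset hsub)
  · rw [G.W_eq_Wr_one, ← show r = 1 from funext h1]
    exact hlim
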